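/- Let $O_{A_{\mathbb N}}$ be the universal $C^*$-algebra generated by a sequence of partial isometries $s_0,s_1,s_2,\dots$ subject to the relations $$s_i^*s_j=0\quad (i\neq j),\qquad s_i^*s_i=\sum_{k=0}^{i}s_ks_k^*\quad (i\ge 0).$$ Let $\mathcal F$ be the weakly monotone Fock space over $\ell^2(\mathbb N)$, $\mathbb N=\{1,2,\dots\}$, that is, the Hilbert space with orthonormal basis consisting of the vacuum vector $\Omega$ and of the vectors $e_{i_1}\otimes\cdots\otimes e_{i_k}$ with $k\ge 1$ and $i_1\ge i_2\ge\cdots\ge i_k\ge 1$. Let $P_\Omega$ be the orthogonal projection of $\mathcal F$ onto $\mathbb C\Omega$ and, for $i\ge 1$, let $A_i^\dagger$ be the bounded operator on $\mathcal F$ with $A_i^\dagger\Omega=e_i$, $A_i^\dagger(e_{i_1}\otimes\cdots\otimes e_{i_k})=e_i\otimes e_{i_1}\otimes\cdots\otimes e_{i_k}$ if $i\ge i_1$, and $A_i^\dagger(e_{i_1}\otimes\cdots\otimes e_{i_k})=0$ otherwise. For $z\in\mathbb T=\{z\in\mathbb C:|z|=1\}$ let $\widetilde\pi_{0,z}:O_{A_{\mathbb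 N}}\to\mathcal B(\mathcal F)$ be the representation determined by $\widetilde\pi_{0,z}(s_0)=zP_\Omega$ and $\widetilde\pi_{0,z}(s_i)=A_i^\dagger$ for $i\ge 1$. Then the direct sum $$\pi:=\bigoplus_{z\in\mathbb T}\widetilde\pi_{0,z}:O_{A_{\mathbb N}}\to\mathcal B\Big(\bigoplus_{z\in\mathbb T}\mathcal F\Big)$$ is a faithful (i.e. injective) representation of $O_{A_{\mathbb N}}$. -/

import Mathlib

open scoped ENNReal

noncomputable section

namespace WeaklyMonotone

/-! ### The universal algebra -/

/-- A sequence of partial isometries `s₀, s₁, …` in a C⋆-algebra with `sᵢ⋆ sⱼ = 0` for `i ≠ j` and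
`sᵢ⋆ sᵢ = ∑_{k ≤ i} sₖ sₖ⋆`. -/
structure IsFamily {B : Type*} [NonUnitalCStarAlgebra B] (s : ℕ → B) : Prop where
  partialIsometry : ∀ i, s i * star (s i) * s i = s i
  orthogonal : ∀ i j, i ≠ j → star (s i) * s j = 0
  source_eq : ∀ i, star (s i) * s i = ∑ k ∈ Finset.range (i + 1), s k * star (s k)

theorem IsFamily.norm_le_one {B : Type*} [NonUnitalCStarAlgebra B] {s : ℕ → B} (h : IsFamily s)
    (i : ℕ) : ‖s i‖ ≤ 1 := by
  have h1 : ‖star (s i) * s i‖ = ‖s i‖ * ‖s i‖ := CStarRing.norm_star_mul_self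
  have h2 : ‖star (star (s i) * s i) * (star (s i) * s i)‖
      = ‖star (s i) * s i‖ * ‖star (s i) * s i‖ := CStarRing.norm_star_mul_self
  have h3 : star (star (s i) * s i) * (star (s i) * s i) = star (s i) * s i := by
    rw [star_mul, star_star, mul_assoc, ← mul_assoc (s i), h.partialIsometry i]
  rw [h3, h1] at h2
  have h4 := norm_nonneg (s i)
  by_contra hc
  push Not at hc
  have h5 : 1 < ‖s i‖ * ‖s i‖ := by nlinarith
  nlinarith

/-- A realization of the generators and relations in some C⋆-algebra. -/
structure Realization where
  carrier : Type
  [inst : NonUnitalCStarAlgebra carrier]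
  family : ℕ → carrier
  isFamily : IsFamily family

instance (r : Realization) : NonUnitalCStarAlgebra r.carrier := r.inst

/-- The C⋆-algebra of bounded elements of the product of all realizations. -/
abbrev Ambient : Type 1 := lp (fun r : Realization => r.carrier) ∞

/-- The `i`-th generators of all realizations, put together. -/
def ambientGen (i : ℕ) : Ambient :=
  ⟨fun r => r.family i, memℓp_infty ⟨1, by
    rintro _ ⟨r, rfl⟩
    exact r.isFamily.norm_le_one i⟩⟩

/-- The closed ⋆-subalgebra generated by the joint generators. The norm of a ⋆-polynomial in the
generators is thus the supremum of its norms in all realizations. -/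
def universalSubalgebra : NonUnitalStarSubalgebra ℂ Ambient :=
  (NonUnitalStarAlgebra.adjoin ℂ (Set.range ambientGen)).topologicalClosure

instance : IsClosed (universalSubalgebra : Set Ambient) :=
  NonUnitalStarSubalgebra.isClosed_topologicalClosure _

/-- The universal C⋆-algebra generated by partial isometries `s₀, s₁, …` with `sᵢ⋆ sⱼ = 0` for
`i ≠ j` and `sᵢ⋆ sᵢ = ∑_{k ≤ i} sₖ sₖ⋆`; see `UniversalAlgebra.existsUnique_lift` for its universal
property. -/
abbrev UniversalAlgebra : Type 1 := universalSubalgebra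

instance : NonUnitalCStarAlgebra UniversalAlgebra :=
  NonUnitalStarSubalgebra.nonUnitalCStarAlgebra universalSubalgebra

namespace UniversalAlgebra

/-- The generators of the universal algebra. -/
def gen (i : ℕ) : UniversalAlgebra :=
  ⟨ambientGen i, NonUnitalStarSubalgebra.le_topologicalClosure _
    (NonUnitalStarAlgebra.subset_adjoin ℂ _ ⟨i, rfl⟩)⟩

/-- The projection onto a realization. -/
def eval (r : Realization) : UniversalAlgebra →⋆ₙₐ[ℂ] r.carrier where
  toFun x := (x : Ambient) r
  map_smul' _ _ := rfl
  map_zero' := rfl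
  map_add' _ _ := rfl
  map_mul' _ _ := rfl
  map_star' _ := rfl

@[simp]
theorem eval_gen (r : Realization) (i : ℕ) : eval r (gen i) = r.family i := rfl

/-- The ⋆-homomorphism defined by the images of the generators. -/
def lift {B : Type} [NonUnitalCStarAlgebra B] (t : ℕ → B) (ht : IsFamily t) :
    UniversalAlgebra →⋆ₙₐ[ℂ] B :=
  eval ⟨B, t, ht⟩

@[simp]
theorem lift_gen {B : Type} [NonUnitalCStarAlgebra B] (t : ℕ → B) (ht : IsFamily t) (i : ℕ) :
    lift t ht (gen i) = t i := rfl

theorem ext_eval {x y : UniversalAlgebra} (h : ∀ r, eval r x = eval r y) : x = y :=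
  Subtype.ext (lp.ext (funext h))

theorem isFamily_gen : IsFamily gen where
  partialIsometry i := ext_eval fun r => by
    simpa only [map_mul, map_star, eval_gen] using r.isFamily.partialIsometry i
  orthogonal i j hij := ext_eval fun r => by
    simpa only [map_mul, map_star, map_zero, eval_gen] using r.isFamily.orthogonal i j hij
  source_eq i := ext_eval fun r => by
    simpa only [map_mul, map_star, map_sum, eval_gen] using r.isFamily.source_eq i

theorem hom_ext {B : Type*} [NonUnitalCStarAlgebra B] {φ ψ : UniversalAlgebra →⋆ₙₐ[ℂ] B}
    (h : ∀ i, φ (gen i) = ψ (gen i)) : φ = ψ := by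
  have key : ∀ (x : Ambient) (hx : x ∈ NonUnitalStarAlgebra.adjoin ℂ (Set.range ambientGen)),
      φ ⟨x, NonUnitalStarSubalgebra.le_topologicalClosure _ hx⟩
        = ψ ⟨x, NonUnitalStarSubalgebra.le_topologicalClosure _ hx⟩ := by
    intro x hx
    induction hx using NonUnitalStarAlgebra.adjoin_induction with
    | mem x hx => obtain ⟨i, rfl⟩ := hx; exact h i
    | add x y hx hy h1 h2 =>
      have := congrArg₂ (· + ·) h1 h2
      simp only [← map_add] at this; exact this
    | zero => exact (map_zero φ).trans (map_zero ψ).symm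
    | mul x y hx hy h1 h2 =>
      have := congrArg₂ (· * ·) h1 h2
      simp only [← map_mul] at this; exact this
    | smul c x hx h1 =>
      have := congrArg (c • ·) h1
      simp only [← map_smul] at this; exact this
    | star x hx h1 =>
      have := congrArg star h1
      simp only [← map_star] at this; exact this
  ext ⟨x, hx⟩
  obtain ⟨u, hu, hux⟩ := mem_closure_iff_seq_limit.1
    (show x ∈ closure (NonUnitalStarAlgebra.adjoin ℂ (Set.range ambientGen) : Set Ambient) from hx)
  have hlim : Filter.Tendsto (fun n => (⟨u n,
      NonUnitalStarSubalgebra.le_topologicalClosure _ (hu n)⟩ : UniversalAlgebra))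
      Filter.atTop (nhds ⟨x, hx⟩) := tendsto_subtype_rng.2 hux
  have cont : ∀ χ : UniversalAlgebra →⋆ₙₐ[ℂ] B, Continuous χ := fun χ =>
    AddMonoidHomClass.continuous_of_bound χ 1 fun a => by
      simpa using NonUnitalStarAlgHom.norm_apply_le χ a
  have h1 := ((cont φ).tendsto _).comp hlim
  have h2 := ((cont ψ).tendsto _).comp hlim
  refine tendsto_nhds_unique h1 (h2.congr fun n => ?_)
  exact (key (u n) (hu n)).symm

end UniversalAlgebra

/-- Formal ⋆-polynomials; they only serve to bound the size of a C⋆-algebra with countably many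
generators. -/
inductive Term : Type
  | gen : ℕ → Term
  | zero : Term
  | add : Term → Term → Term
  | mul : Term → Term → Term
  | smul : ℂ → Term → Term
  | star : Term → Term

/-- The value of a formal ⋆-polynomial. -/
def Term.eval {B : Type*} [NonUnitalCStarAlgebra B] (t : ℕ → B) : Term → B
  | .gen i => t i
  | .zero => 0
  | .add a b => a.eval t + b.eval t
  | .mul a b => a.eval t * b.eval t
  | .smul c a => c • a.eval t
  | .star a => Star.star (a.eval t)

open Filter Topology in
theorem small_closure {B : Type*} [NonUnitalCStarAlgebra B] (t : ℕ → B) :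
    Small.{0} (NonUnitalStarAlgebra.adjoin ℂ (Set.range t)).topologicalClosure := by
  have h1 : ∀ x ∈ NonUnitalStarAlgebra.adjoin ℂ (Set.range t), ∃ a : Term, a.eval t = x := by
    intro x hx
    induction hx using NonUnitalStarAlgebra.adjoin_induction with
    | mem x hx => obtain ⟨i, rfl⟩ := hx; exact ⟨.gen i, rfl⟩
    | add x y hx hy h1 h2 =>
      obtain ⟨a, rfl⟩ := h1; obtain ⟨b, rfl⟩ := h2; exact ⟨.add a b, rfl⟩
    | zero => exact ⟨.zero, rfl⟩
    | mul x y hx hy h1 h2 =>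
      obtain ⟨a, rfl⟩ := h1; obtain ⟨b, rfl⟩ := h2; exact ⟨.mul a b, rfl⟩
    | smul c x hx h1 => obtain ⟨a, rfl⟩ := h1; exact ⟨.smul c a, rfl⟩
    | star x hx h1 => obtain ⟨a, rfl⟩ := h1; exact ⟨.star a, rfl⟩
  have h2 : ((NonUnitalStarAlgebra.adjoin ℂ (Set.range t)).topologicalClosure : Set B) ⊆
      Set.range fun f : ℕ → Term => limUnder Filter.atTop fun n => (f n).eval t := by
    intro x hx
    obtain ⟨u, hu, hux⟩ := mem_closure_iff_seq_limit.1
      (show x ∈ closure (NonUnitalStarAlgebra.adjoin ℂ (Set.range t) : Set B) from hx)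
    choose f hf using fun n => h1 (u n) (hu n)
    exact ⟨f, by simp only [hf]; exact hux.limUnder_eq⟩
  exact small_subset h2

/-- A C⋆-algebra with a small underlying type has an isomorphic copy in the lowest universe. -/
theorem exists_copy (B : Type*) [NonUnitalCStarAlgebra B] [Small.{0} B] :
    ∃ (C : Type) (_ : NonUnitalCStarAlgebra C), Nonempty (C ≃⋆ₐ[ℂ] B) := by
  let e : Shrink.{0} B ≃ B := (equivShrink B).symm
  let _ : NonUnitalRing (Shrink.{0} B) := e.nonUnitalRing
  let _ : Module ℂ (Shrink.{0} B) := e.module ℂ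
  let f : Shrink.{0} B →ₙₐ[ℂ] B :=
    { toFun := e
      map_smul' := fun c x => e.apply_symm_apply _
      map_zero' := e.apply_symm_apply _
      map_add' := fun x y => e.apply_symm_apply _
      map_mul' := fun x y => e.apply_symm_apply _ }
  have hf : Function.Injective f := e.injective
  let _ : NonUnitalNormedRing (Shrink.{0} B) := NonUnitalNormedRing.induced _ _ f hf
  have hn : ∀ x, ‖x‖ = ‖f x‖ := fun x => rfl
  let _ : NormedSpace ℂ (Shrink.{0} B) := NormedSpace.induced ℂ _ _ f
  have hstar : ∀ x, f (e.symm (star (f x))) = star (f x) := fun x => e.apply_symm_apply _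
  let _ : StarRing (Shrink.{0} B) :=
    { star := fun x => e.symm (star (f x))
      star_involutive := fun x => hf (by rw [hstar, hstar, star_star])
      star_mul := fun x y => hf (by rw [hstar, map_mul, map_mul, hstar, hstar, star_mul])
      star_add := fun x y => hf (by rw [hstar, map_add, map_add, hstar, hstar, star_add]) }
  have hst : ∀ x, f (star x) = star (f x) := hstar
  have hiso : Isometry f := AddMonoidHomClass.isometry_of_norm f fun x => rfl
  have hc : CompleteSpace (Shrink.{0} B) :=
    (hiso.isUniformInducing.completeSpace_congr e.surjective).2 inferInstance
  refine ⟨Shrink.{0} B,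
    { norm_mul_self_le := fun x => by
        rw [hn, hn, map_mul, hst, CStarRing.norm_star_mul_self]
      smul_assoc := fun c x y => hf (by simp [smul_mul_assoc])
      smul_comm := fun c x y => hf (by simp [mul_smul_comm])
      star_smul := fun c x => hf (by simp [hst])
      norm_smul_le := norm_smul_le }, ⟨?_⟩⟩
  exact
    { e with
      map_mul' := map_mul f
      map_add' := map_add f
      map_star' := hst
      map_smul' := map_smul f }

/-- The universal property, with respect to C⋆-algebras in any universe. -/
theorem UniversalAlgebra.existsUnique_lift {B : Type*} [NonUnitalCStarAlgebra B] (t : ℕ → B)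
    (ht : IsFamily t) : ∃! φ : UniversalAlgebra →⋆ₙₐ[ℂ] B, ∀ i, φ (gen i) = t i := by
  let S := (NonUnitalStarAlgebra.adjoin ℂ (Set.range t)).topologicalClosure
  have _ : IsClosed (S : Set B) := NonUnitalStarSubalgebra.isClosed_topologicalClosure _
  have _ : Small.{0} S := small_closure t
  obtain ⟨C, _, ⟨e⟩⟩ := exists_copy S
  let t' : ℕ → S := fun i => ⟨t i, NonUnitalStarSubalgebra.le_topologicalClosure _
    (NonUnitalStarAlgebra.subset_adjoin ℂ _ ⟨i, rfl⟩)⟩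
  have ht' : IsFamily t' :=
    ⟨fun i => Subtype.ext (ht.partialIsometry i), fun i j h => Subtype.ext (ht.orthogonal i j h),
      fun i => Subtype.ext (by simpa [t'] using ht.source_eq i)⟩
  have hC : IsFamily fun i => e.symm (t' i) :=
    ⟨fun i => by simpa only [map_mul, map_star] using congrArg e.symm (ht'.partialIsometry i),
      fun i j h => by
        simpa only [map_mul, map_star, map_zero] using congrArg e.symm (ht'.orthogonal i j h),
      fun i => by
        simpa only [map_mul, map_star, map_sum] using congrArg e.symm (ht'.source_eq i)⟩
  refine ⟨(NonUnitalStarSubalgebraClass.subtype S).comp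
    ((e : C →⋆ₙₐ[ℂ] S).comp (lift _ hC)), fun i => ?_, fun ψ hψ => hom_ext fun i => ?_⟩
  · simp [t']
  · rw [hψ]; simp [t']

/-! ### Direct sums of representations -/

section DirectSum

variable {ι : Type*} {H : ι → Type*} [∀ i, NormedAddCommGroup (H i)]
  [∀ i, InnerProductSpace ℂ (H i)]

/-- The operator `⊕ᵢ Tᵢ` on the Hilbert space direct sum `⊕ᵢ Hᵢ`, for a uniformly bounded family of
operators. -/
def directSumOp (T : ∀ i, H i →L[ℂ] H i) (C : ℝ) (hT : ∀ i, ‖T i‖ ≤ C) :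
    lp H 2 →L[ℂ] lp H 2 :=
  have hle : ∀ (ξ : lp H 2) (i : ι), ‖T i (ξ i)‖ ≤ ‖(((|C| : ℝ) : ℂ) • ξ : lp H 2) i‖ := fun ξ i => by
    rw [lp.coeFn_smul, Pi.smul_apply, norm_smul, Complex.norm_real, norm_abs_eq_norm]
    exact (T i).le_of_opNorm_le ((hT i).trans (le_abs_self C)) (ξ i)
  LinearMap.mkContinuous
    { toFun := fun ξ => ⟨fun i => T i (ξ i),
        (lp.memℓp (((|C| : ℝ) : ℂ) • ξ : lp H 2)).mono' (hle ξ)⟩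
      map_add' := fun ξ η => lp.ext (funext fun i => (T i).map_add _ _)
      map_smul' := fun c ξ => lp.ext (funext fun i => (T i).map_smul _ _) } |C| fun ξ => by
    refine (lp.norm_mono two_ne_zero (hle ξ)).trans_eq ?_
    rw [norm_smul, Complex.norm_real, norm_abs_eq_norm, Real.norm_eq_abs]

@[simp]
theorem directSumOp_apply (T : ∀ i, H i →L[ℂ] H i) (C : ℝ) (hT : ∀ i, ‖T i‖ ≤ C) (ξ : lp H 2)
    (i : ι) : directSumOp T C hT ξ i = T i (ξ i) := rfl

variable [∀ i, CompleteSpace (H i)]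

/-- The direct sum `⊕ᵢ πᵢ` of a family of representations of a C⋆-algebra. -/
def directSumRep {A : Type*} [NonUnitalCStarAlgebra A] (π : ∀ i, A →⋆ₙₐ[ℂ] (H i →L[ℂ] H i)) :
    A →⋆ₙₐ[ℂ] (lp H 2 →L[ℂ] lp H 2) where
  toFun a := directSumOp (fun i => π i a) ‖a‖ fun i => NonUnitalStarAlgHom.norm_apply_le (π i) a
  map_smul' c a := by ext ξ i; simp
  map_zero' := by ext ξ i; simp
  map_add' a b := by ext ξ i; simp
  map_mul' a b := by ext ξ i; simp
  map_star' a := by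
    rw [ContinuousLinearMap.star_eq_adjoint, ContinuousLinearMap.eq_adjoint_iff]
    intro ξ η
    rw [lp.inner_eq_tsum, lp.inner_eq_tsum]
    refine tsum_congr fun i => ?_
    simp [map_star, ContinuousLinearMap.star_eq_adjoint, ContinuousLinearMap.adjoint_inner_left]

@[simp]
theorem directSumRep_apply {A : Type*} [NonUnitalCStarAlgebra A]
    (π : ∀ i, A →⋆ₙₐ[ℂ] (H i →L[ℂ] H i)) (a : A) (ξ : lp H 2) (i : ι) :
    directSumRep π a ξ i = π i a (ξ i) := rfl

end DirectSum

/-! ### The weakly monotone Fock space -/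

section PartialBijection

variable {α : Type*}

/-- The partial isometry of `ℓ²(α)` induced by a partial bijection `f` of `α`: it maps the basis
vector `e_a` to `e_{f a}` if `f a` is defined, and to `0` otherwise. -/
def partialOp (f : α ≃. α) : lp (fun _ : α => ℂ) 2 →L[ℂ] lp (fun _ : α => ℂ) 2 :=
  have h2 : (0 : ℝ) < (2 : ℝ≥0∞).toReal := by norm_num
  have hle : ∀ (ξ : lp (fun _ : α => ℂ) 2) (s : Finset α),
      ∑ b ∈ s, ‖(f.symm b).elim 0 ξ‖ ^ (2 : ℝ≥0∞).toReal ≤ ‖ξ‖ ^ (2 : ℝ≥0∞).toReal := by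
    intro ξ s
    classical
    refine le_trans ?_ (lp.sum_rpow_le_norm_rpow h2 ξ
      (s.filterMap f.symm fun a b c ha hb => f.symm.inj ha hb))
    rw [← Finset.sum_filter_of_ne (p := fun b => (f.symm b).isSome)]
    · refine le_of_eq (Finset.sum_bij (fun b hb => (f.symm b).get (Finset.mem_filter.1 hb).2)
        ?_ ?_ ?_ ?_)
      · intro b hb
        exact Finset.mem_filterMap _ |>.2 ⟨b, (Finset.mem_filter.1 hb).1, by simp⟩
      · intro b hb c hc h
        refine f.symm.inj (Option.get_mem (Finset.mem_filter.1 hb).2) ?_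
        rw [h]
        exact Option.get_mem _
      · intro a ha
        obtain ⟨b, hb, h⟩ := Finset.mem_filterMap _ |>.1 ha
        exact ⟨b, Finset.mem_filter.2 ⟨hb, by simp [h]⟩, by simp [h]⟩
      · intro b hb
        obtain ⟨a, ha⟩ := Option.isSome_iff_exists.1 (Finset.mem_filter.1 hb).2
        simp [ha]
    · intro b _ hb
      by_contra h
      simp_all
  LinearMap.mkContinuous
    { toFun := fun ξ => ⟨fun b => (f.symm b).elim 0 ξ, memℓp_gen' (hle ξ)⟩
      map_add' := fun ξ η => lp.ext (funext fun b => by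
        change (f.symm b).elim 0 ⇑(ξ + η) = (f.symm b).elim 0 ξ + (f.symm b).elim 0 η
        rcases f.symm b with _ | a
        · simp only [Option.elim_none, add_zero]
        · rfl)
      map_smul' := fun c ξ => lp.ext (funext fun b => by
        change (f.symm b).elim 0 ⇑(c • ξ) = c • (f.symm b).elim 0 ξ
        rcases f.symm b with _ | a
        · simp only [Option.elim_none, smul_zero]
        · rfl) } 1 fun ξ => by
    rw [one_mul]
    exact lp.norm_le_of_forall_sum_le h2 (norm_nonneg ξ) (hle ξ)

theorem partialOp_apply (f : α ≃. α) (ξ : lp (fun _ : α => ℂ) 2) (b : α) :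
    partialOp f ξ b = (f.symm b).elim 0 ξ := rfl

theorem partialOp_single [DecidableEq α] (f : α ≃. α) (a : α) (c : ℂ) :
    partialOp f (lp.single 2 a c) = (f a).elim 0 fun b => lp.single 2 b c := by
  ext b
  rw [partialOp_apply]
  rcases h : f a with _ | b'
  · rcases h' : f.symm b with _ | a'
    · simp
    · have := (f.eq_some_iff).1 h'
      have hne : a' ≠ a := by rintro rfl; simp_all
      simp [hne]
  · have hb := (f.eq_some_iff).2 h
    by_cases hbb : b = b'
    · subst hbb; simp [hb]
    · rcases h' : f.symm b with _ | a'
      · simp [hbb]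
      · have := (f.eq_some_iff).1 h'
        have hne : a' ≠ a := by rintro rfl; simp_all
        simp [hne, hbb]

theorem star_partialOp (f : α ≃. α) : star (partialOp f) = partialOp f.symm := by
  classical
  rw [ContinuousLinearMap.star_eq_adjoint]
  ext ξ a
  have h := lp.inner_single_left (𝕜 := ℂ) (G := fun _ : α => ℂ) a 1
    (ContinuousLinearMap.adjoint (partialOp f) ξ)
  rw [ContinuousLinearMap.adjoint_inner_right, partialOp_single] at h
  rw [partialOp_apply, PEquiv.symm_symm]
  rcases hfa : f a with _ | b
  · rw [hfa] at h; simpa using h.symm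
  · rw [hfa] at h
    simp only [Option.elim_some, lp.inner_single_left] at h
    simpa using h.symm

end PartialBijection

/-- Weakly decreasing finite words `i₁ ≥ i₂ ≥ … ≥ iₖ ≥ 1`, including the empty word. -/
abbrev Word : Type := {l : List ℕ+ // l.IsChain (· ≥ ·)}

/-- The weakly monotone Fock space over `ℓ²(ℕ)`, `ℕ = {1, 2, …}`: the Hilbert space whose canonical
orthonormal basis consists of the vectors `e_{i₁} ⊗ ⋯ ⊗ e_{iₖ}` with `i₁ ≥ ⋯ ≥ iₖ ≥ 1`, indexed here
by the words `i₁ ⋯ iₖ`. -/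
abbrev Fock : Type := lp (fun _ : Word => ℂ) 2

/-- The basis vector `e_{i₁} ⊗ ⋯ ⊗ e_{iₖ}`. -/
def basisVec (w : Word) : Fock := lp.single 2 w 1

/-- The vacuum vector. -/
def vacuum : Fock := basisVec ⟨[], List.isChain_nil⟩

/-- The orthogonal projection onto the vacuum vector. -/
def vacuumProj : Fock →L[ℂ] Fock := (ℂ ∙ vacuum).starProjection

/-- The partial bijection `w ↦ i w`, defined if `i w` is weakly decreasing. -/
def prepend (i : ℕ+) : Word ≃. Word where
  toFun w := if h : (i :: w.1).IsChain (· ≥ ·) then some ⟨i :: w.1, h⟩ else none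
  invFun
    | ⟨[], _⟩ => none
    | ⟨j :: l, h⟩ => if j = i then some ⟨l, h.tail⟩ else none
  inv := by
    rintro ⟨a, ha⟩ ⟨_ | ⟨j, l⟩, h⟩
    · simp
    · by_cases hj : j = i
      · subst hj
        constructor
        · intro e
          obtain rfl : l = a := congrArg Subtype.val (Option.some.inj ((if_pos rfl).symm.trans e))
          exact dif_pos h
        · intro e
          by_cases hc : (j :: a).IsChain (· ≥ ·)
          · rw [dif_pos hc] at e
            have e' : j :: a = j :: l := congrArg Subtype.val (Option.some.inj e)
            obtain rfl : a = l := (List.cons.inj e').2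
            exact if_pos rfl
          · rw [dif_neg hc] at e
            exact absurd e (by simp)
      · simp [hj, Ne.symm hj]

/-- The weakly monotone creator `Aᵢ†`. -/
def creator (i : ℕ+) : Fock →L[ℂ] Fock := partialOp (prepend i)

theorem creator_vacuum (i : ℕ+) :
    creator i vacuum = basisVec ⟨[i], List.isChain_singleton i⟩ := by
  simp [creator, vacuum, basisVec, partialOp_single, prepend]

theorem creator_basisVec_of_le (i j : ℕ+) (l : List ℕ+) (h : (j :: l).IsChain (· ≥ ·))
    (hij : j ≤ i) :
    creator i (basisVec ⟨j :: l, h⟩)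
      = basisVec ⟨i :: j :: l, List.isChain_cons_cons.2 ⟨hij, h⟩⟩ := by
  have : (i :: j :: l).IsChain (· ≥ ·) := List.isChain_cons_cons.2 ⟨hij, h⟩
  simp [creator, basisVec, partialOp_single, prepend, -List.isChain_cons_cons, this]

theorem creator_basisVec_of_lt (i j : ℕ+) (l : List ℕ+) (h : (j :: l).IsChain (· ≥ ·))
    (hij : i < j) : creator i (basisVec ⟨j :: l, h⟩) = 0 := by
  have : ¬ (i :: j :: l).IsChain (· ≥ ·) := fun hc =>
    absurd (List.isChain_cons_cons.1 hc).1 (not_le.2 hij)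
  simp [creator, basisVec, partialOp_single, prepend, -List.isChain_cons_cons, this]

theorem creator_apply_nil (i : ℕ+) (ξ : Fock) (h : [].IsChain (· ≥ ·)) :
    creator i ξ ⟨[], h⟩ = 0 := rfl

theorem creator_apply_cons (i j : ℕ+) (l : List ℕ+) (h : (j :: l).IsChain (· ≥ ·)) (ξ : Fock) :
    creator i ξ ⟨j :: l, h⟩ = if j = i then ξ ⟨l, h.tail⟩ else 0 := by
  rw [creator, partialOp_apply]
  change (if j = i then some (⟨l, h.tail⟩ : Word) else none).elim 0 ξ = _
  split_ifs <;> rfl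

theorem star_creator_apply (i : ℕ+) (w : Word) (ξ : Fock) :
    (star (creator i)) ξ w = if h : (i :: w.1).IsChain (· ≥ ·) then ξ ⟨i :: w.1, h⟩ else 0 := by
  rw [creator, star_partialOp, partialOp_apply]
  change (if h : (i :: w.1).IsChain (· ≥ ·) then some (⟨i :: w.1, h⟩ : Word) else none).elim 0 ξ = _
  split_ifs <;> rfl

theorem vacuumProj_apply (ξ : Fock) : vacuumProj ξ = ξ ⟨[], List.isChain_nil⟩ • vacuum := by
  have hn : ‖vacuum‖ = 1 := by
    rw [vacuum, basisVec, lp.norm_single (by norm_num)]; simp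
  rw [vacuumProj, Submodule.starProjection_unit_singleton ℂ hn, vacuum, basisVec,
    lp.inner_single_left]
  simp

/-- The images of the generators under the representation with phase `z`: `s₀ ↦ z P_Ω` and
`sᵢ ↦ Aᵢ†` for `i ≥ 1`. -/
def fockFamily (z : Circle) : ℕ → (Fock →L[ℂ] Fock)
  | 0 => (z : ℂ) • vacuumProj
  | n + 1 => creator n.succPNat

theorem isFamily_fockFamily (z : Circle) : IsFamily (fockFamily z) := by
  have hz : (starRingEnd ℂ) z * z = 1 := by
    rw [← Complex.normSq_eq_conj_mul_self, Circle.normSq_coe, Complex.ofReal_one]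
  have hz' : (z : ℂ) * (starRingEnd ℂ) z = 1 := by rw [mul_comm, hz]
  have hP : star vacuumProj = vacuumProj := isSelfAdjoint_starProjection _
  have hPP : vacuumProj * vacuumProj = vacuumProj :=
    Submodule.isIdempotentElem_starProjection _
  have hV : ∀ (j : ℕ+) (l : List ℕ+) (h : (j :: l).IsChain (· ≥ ·)), vacuum ⟨j :: l, h⟩ = 0 :=
    fun j l h => lp.single_apply_ne _ _ _ (by simp)
  have hV0 : ∀ h : [].IsChain (· ≥ ·), vacuum ⟨[], h⟩ = 1 := fun h => lp.single_apply_self _ _ _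
  have h00 : star (fockFamily z 0) * fockFamily z 0 = vacuumProj := by
    simp [fockFamily, star_smul, hP, hPP, smul_smul, hz']
  have h00' : fockFamily z 0 * star (fockFamily z 0) = vacuumProj := by
    simp [fockFamily, star_smul, hP, hPP, smul_smul, hz]
  have hsrc : ∀ (i : ℕ+) (ξ : Fock) (w : Word), (star (creator i) * creator i) ξ w
      = if (i :: w.1).IsChain (· ≥ ·) then ξ w else 0 := by
    intro i ξ w
    rw [mul_apply_eq_comp, star_creator_apply]
    split_ifs with h
    · rw [creator_apply_cons, if_pos rfl]
    · rfl
  have hrng : ∀ (i j : ℕ+) (l : List ℕ+) (h : (j :: l).IsChain (· ≥ ·)) (ξ : Fock),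
      (creator i * star (creator i)) ξ ⟨j :: l, h⟩ = if j = i then ξ ⟨j :: l, h⟩ else 0 := by
    intro i j l h ξ
    rw [mul_apply_eq_comp, creator_apply_cons]
    split_ifs with hji
    · subst hji
      rw [star_creator_apply, dif_pos h]
    · rfl
  have hPc : ∀ i : ℕ+, vacuumProj * creator i = 0 := by
    intro i
    ext ξ : 1
    rw [mul_apply_eq_comp, vacuumProj_apply, creator_apply_nil, zero_smul]
    rfl
  refine ⟨?_, ?_, ?_⟩
  · rintro (_ | n)
    · rw [h00']
      simp [fockFamily, hPP]
    · ext ξ w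
      rw [mul_assoc]
      change creator n.succPNat ((star (creator n.succPNat) * creator n.succPNat) ξ) w
        = creator n.succPNat ξ w
      obtain ⟨_ | ⟨j, l⟩, h⟩ := w
      · rfl
      · rw [creator_apply_cons, creator_apply_cons]
        split_ifs with hj
        · subst hj
          rw [hsrc, if_pos h]
        · rfl
  · rintro (_ | m) (_ | n) hmn
    · exact absurd rfl hmn
    · simp [fockFamily, star_smul, hP, hPc]
    · rw [← star_eq_zero, star_mul, star_star]
      simp [fockFamily, star_smul, hP, hPc]
    · ext ξ w
      change (star (creator m.succPNat) * creator n.succPNat) ξ w = 0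
      rw [mul_apply_eq_comp, star_creator_apply]
      split_ifs with h
      · rw [creator_apply_cons, if_neg]
        intro e
        exact hmn (congrArg (· + 1) (Nat.succPNat_injective e))
      · rfl
  · rintro (_ | n)
    · rw [h00]
      simp [h00']
    · rw [Finset.sum_range_succ', h00']
      change star (creator n.succPNat) * creator n.succPNat
        = ∑ k ∈ Finset.range (n + 1), creator k.succPNat * star (creator k.succPNat) + vacuumProj
      ext ξ w
      rw [hsrc, add_apply, sum_apply, lp.coeFn_add,
        Pi.add_apply, lp.coeFn_sum, Finset.sum_apply, vacuumProj_apply, lp.coeFn_smul,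
        Pi.smul_apply]
      obtain ⟨_ | ⟨j, l⟩, h⟩ := w
      · have h0 : ∀ k ∈ Finset.range (n + 1),
            (creator k.succPNat * star (creator k.succPNat)) ξ ⟨[], h⟩ = 0 := fun k _ => rfl
        have h1 := Finset.sum_eq_zero h0
        rw [hV0, if_pos (List.isChain_singleton _)]
        refine Eq.trans ?_ (congrArg (· + _) h1.symm)
        simp
      · obtain ⟨m, rfl⟩ : ∃ m : ℕ, j = m.succPNat := ⟨j.natPred, j.succPNat_natPred.symm⟩
        simp only [hV, hrng, smul_zero, add_zero, Nat.succPNat_inj, Finset.sum_ite_eq,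
          Finset.mem_range]
        refine if_congr ?_ rfl rfl
        rw [List.isChain_cons_cons, and_iff_left h, ge_iff_le, Nat.succPNat_le_succPNat,
          Nat.lt_succ_iff]

/-- The representation of the universal algebra on the weakly monotone Fock space with
`s₀ ↦ z P_Ω` and `sᵢ ↦ Aᵢ†` for `i ≥ 1`. -/
def fockRep (z : Circle) : UniversalAlgebra →⋆ₙₐ[ℂ] (Fock →L[ℂ] Fock) :=
  UniversalAlgebra.lift (fockFamily z) (isFamily_fockFamily z)

theorem fockRep_gen_zero (z : Circle) :
    fockRep z (UniversalAlgebra.gen 0) = (z : ℂ) • vacuumProj := rfl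

theorem fockRep_gen_pos (z : Circle) (i : ℕ+) :
    fockRep z (UniversalAlgebra.gen i) = creator i := by
  obtain ⟨n, rfl⟩ : ∃ n : ℕ, i = n.succPNat := ⟨i.natPred, i.succPNat_natPred.symm⟩
  rfl

end WeaklyMonotone

end

/-!
The direct sum is shown to be bounded below by the universal norm, by a growth argument. Let `b` be
a ⋆-polynomial in the generators and `x = b⋆ b`. The relations rewrite a product of monomials
`t_μ t_ν⋆` into monomials whose lengths add up, so `x ^ m` is a combination of monomials of length
`O(m)` in a fixed finite set of letters. Moreover `t_μ = 0` unless `μ` is weakly decreasing, so only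
polynomially many monomials occur, and inserting `tᵢ = ∑_{k ≤ i} tᵢ tₖ tₖ⋆` at the end of `μ` brings
all the words `μ` to the same length `L`.

In such a combination each coefficient is bounded by `sup_z ‖π_z (x ^ m)‖`: a matrix coefficient of
`π_z` on the Fock space determines `μ` and `ν` up to their letters `0`, and the remaining numbers
of zeros are read off from the fixed length `L` and from the power of `z`, that is, from a Fourier
coefficient in `z`. As the monomials are contractions, `‖x ^ m‖ ≤ p(m) · sup_z ‖π_z x‖ ^ m` with a
polynomial `p`, and taking `m`-th roots removes `p`.
-/

namespace WeaklyMonotone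

section Relations

variable {A B : Type*} [NonUnitalCStarAlgebra A] [NonUnitalCStarAlgebra B] {t : ℕ → B}

theorem IsFamily.source_mul_of_le (ht : IsFamily t) {i j : ℕ} (hij : j ≤ i) :
    star (t i) * t i * t j = t j := by
  rw [ht.source_eq, Finset.sum_mul,
    Finset.sum_eq_single_of_mem j (Finset.mem_range.2 (Nat.lt_succ_of_le hij)),
    ht.partialIsometry]
  intro k _ hk
  rw [mul_assoc, ht.orthogonal k j hk, mul_zero]

theorem IsFamily.source_mul_of_lt (ht : IsFamily t) {i j : ℕ} (hij : i < j) :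
    star (t i) * t i * t j = 0 := by
  rw [ht.source_eq, Finset.sum_mul]
  refine Finset.sum_eq_zero fun k hk => ?_
  have hkj : k ≠ j := by have := Finset.mem_range.1 hk; omega
  rw [mul_assoc, ht.orthogonal k j hkj, mul_zero]

theorem IsFamily.mul_eq_zero_of_lt (ht : IsFamily t) {i j : ℕ} (hij : i < j) : t i * t j = 0 := by
  rw [← ht.partialIsometry i, mul_assoc (t i), mul_assoc, ht.source_mul_of_lt hij, mul_zero]

theorem IsFamily.map {s : ℕ → A} (hs : IsFamily s) (φ : A →⋆ₙₐ[ℂ] B) :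
    IsFamily fun i => φ (s i) where
  partialIsometry i := by simp only [← map_mul, ← map_star, hs.partialIsometry i]
  orthogonal i j hij := by simp only [← map_mul, ← map_star, hs.orthogonal i j hij, map_zero]
  source_eq i := by simp only [← map_mul, ← map_star, ← map_sum, hs.source_eq i]

end Relations

section Monomial

variable {ι A B : Type*}

/-- The monomial `t_μ t_ν⋆`, where `t_μ` is the product of the `t i` along the word `μ`. -/
def monomial [Monoid B] [Star B] (t : ι → B) (μ ν : List ι) : B :=
  (μ.map t).prod * star (ν.map t).prod

theorem star_monomial [Monoid B] [StarMul B] (t : ι → B) (μ ν : List ι) :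
    star (monomial t μ ν) = monomial t ν μ := by
  simp [monomial]

theorem map_monomial [Monoid A] [StarMul A] [Monoid B] [StarMul B] {F : Type*} [FunLike F A B]
    [MonoidHomClass F A B] [StarHomClass F A B] (φ : F) (t : ι → A) (μ ν : List ι) :
    φ (monomial t μ ν) = monomial (fun i => φ (t i)) μ ν := by
  simp [monomial, map_list_prod, map_star, Function.comp_def]

variable [CStarAlgebra B] {t : ℕ → B}

theorem IsFamily.prod_eq_zero (ht : IsFamily t) {μ : List ℕ} (hμ : ¬ μ.IsChain (· ≥ ·)) :
    (μ.map t).prod = 0 := by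
  induction μ with
  | nil => exact absurd List.isChain_nil hμ
  | cons i μ ih =>
    by_cases hchain : μ.IsChain (· ≥ ·)
    · obtain _ | ⟨j, μ⟩ := μ
      · exact absurd (List.isChain_singleton i) hμ
      · have hij : i < j := by
          by_contra hji
          exact hμ (List.isChain_cons_cons.2 ⟨not_lt.1 hji, hchain⟩)
        rw [List.map_cons, List.map_cons, List.prod_cons, List.prod_cons, ← mul_assoc,
          ht.mul_eq_zero_of_lt hij, zero_mul]
    · rw [List.map_cons, List.prod_cons, ih hchain, mul_zero]

theorem IsFamily.isChain_of_monomial_ne_zero (ht : IsFamily t) {μ ν : List ℕ}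
    (h : monomial t μ ν ≠ 0) : μ.IsChain (· ≥ ·) ∧ ν.IsChain (· ≥ ·) := by
  constructor <;> by_contra hc <;> exact h (by simp [monomial, ht.prod_eq_zero hc])

theorem norm_prod_map_le_one {t : ι → B} (ht : ∀ i, ‖t i‖ ≤ 1) (μ : List ι) :
    ‖(μ.map t).prod‖ ≤ 1 := by
  nontriviality B
  induction μ with
  | nil => simp
  | cons i μ ih =>
    rw [List.map_cons, List.prod_cons]
    exact (norm_mul_le _ _).trans (mul_le_one₀ (ht i) (norm_nonneg _) ih)

theorem norm_monomial_le_one {t : ι → B} (ht : ∀ i, ‖t i‖ ≤ 1) (μ ν : List ι) :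
    ‖monomial t μ ν‖ ≤ 1 :=
  (norm_mul_le _ _).trans <| mul_le_one₀ (norm_prod_map_le_one ht μ) (norm_nonneg _) <|
    (norm_star _).trans_le (norm_prod_map_le_one ht ν)

theorem IsFamily.monomial_eq_sum (ht : IsFamily t) (μ : List ℕ) (i : ℕ) (ν : List ℕ) :
    monomial t (μ ++ [i]) ν
      = ∑ k ∈ Finset.range (i + 1), monomial t (μ ++ [i] ++ [k]) (ν ++ [k]) :=
  calc monomial t (μ ++ [i]) ν
      = (μ.map t).prod * t i * (star (t i) * t i) * star (ν.map t).prod := by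
        rw [mul_assoc _ (t i), ← mul_assoc (t i), ht.partialIsometry]
        simp [monomial]
    _ = _ := by
        rw [ht.source_eq, Finset.mul_sum, Finset.sum_mul]
        simp [monomial, mul_assoc]

end Monomial

section MonomialSpan

/-- The words with letters at most `n` whose length lies in `I`. -/
def words (n : ℕ) (I : Set ℕ) : Set (List ℕ) :=
  {μ | (∀ i ∈ μ, i ≤ n) ∧ μ.length ∈ I}

theorem mem_words {n : ℕ} {I : Set ℕ} {μ : List ℕ} :
    μ ∈ words n I ↔ (∀ i ∈ μ, i ≤ n) ∧ μ.length ∈ I :=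
  Iff.rfl

theorem words_mono {n n' : ℕ} {I I' : Set ℕ} (hn : n ≤ n') (hI : I ⊆ I') :
    words n I ⊆ words n' I' :=
  fun _ hμ => ⟨fun i hi => (hμ.1 i hi).trans hn, hI hμ.2⟩

/-- The span of the monomials `t_μ t_ν⋆` with `μ ∈ U` and `ν ∈ V`. -/
def monomialSpan {ι B : Type*} [Ring B] [StarRing B] [Algebra ℂ B] (t : ι → B)
    (U V : Set (List ι)) : Submodule ℂ B :=
  Submodule.span ℂ (Set.image2 (monomial t) U V)

/-- The span of the monomials in two non-empty words of length at most `d` with letters at most `n`.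
It filters the ⋆-algebra generated by `t`; see `IsFamily.mul_mem_filtration`. -/
def filtration {B : Type*} [Ring B] [StarRing B] [Algebra ℂ B] (t : ℕ → B) (n d : ℕ) :
    Submodule ℂ B :=
  monomialSpan t (words n (Set.Icc 1 d)) (words n (Set.Icc 1 d))

section Ring

variable {ι B : Type*} [Ring B] [StarRing B] [Algebra ℂ B] {t : ι → B}

theorem monomial_mem_monomialSpan {U V : Set (List ι)} {μ ν : List ι} (hμ : μ ∈ U) (hν : ν ∈ V) :
    monomial t μ ν ∈ monomialSpan t U V :=
  Submodule.subset_span (Set.mem_image2_of_mem hμ hν)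

theorem monomialSpan_le_iff {U V : Set (List ι)} {N : Submodule ℂ B} :
    monomialSpan t U V ≤ N ↔ ∀ μ ∈ U, ∀ ν ∈ V, monomial t μ ν ∈ N :=
  Submodule.span_le.trans Set.image2_subset_iff

theorem monomialSpan_mono {U U' V V' : Set (List ι)} (hU : U ⊆ U') (hV : V ⊆ V') :
    monomialSpan t U V ≤ monomialSpan t U' V' :=
  Submodule.span_mono (Set.image2_subset hU hV)

theorem star_mem_monomialSpan [StarModule ℂ B] {U V : Set (List ι)} {x : B}
    (hx : x ∈ monomialSpan t U V) : star x ∈ monomialSpan t V U := by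
  induction hx using Submodule.span_induction with
  | mem x hx =>
    obtain ⟨μ, hμ, ν, hν, rfl⟩ := hx
    rw [star_monomial]
    exact monomial_mem_monomialSpan hν hμ
  | zero => simp
  | add x y _ _ hx hy => rw [star_add]; exact add_mem hx hy
  | smul c x _ hx => rw [star_smul]; exact Submodule.smul_mem _ _ hx

theorem filtration_mono {t : ℕ → B} {n n' d d' : ℕ} (hn : n ≤ n') (hd : d ≤ d') :
    filtration t n d ≤ filtration t n' d' :=
  have h := words_mono hn (Set.Icc_subset_Icc_right hd)
  monomialSpan_mono h h

theorem prod_mul_mem_monomialSpan {t : ℕ → B} {n a : ℕ} {V : Set (List ℕ)} {μ : List ℕ}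
    (hμ : ∀ i ∈ μ, i ≤ n) {x : B} (hx : x ∈ monomialSpan t (words n (Set.Iic a)) V) :
    (μ.map t).prod * x
      ∈ monomialSpan t (words n (Set.Icc μ.length (μ.length + a))) V := by
  suffices h : monomialSpan t (words n (Set.Iic a)) V ≤
      (monomialSpan t (words n (Set.Icc μ.length (μ.length + a))) V).comap
        (LinearMap.mulLeft ℂ (μ.map t).prod) from h hx
  refine monomialSpan_le_iff.2 fun α hα β hβ => ?_
  have heq : (μ.map t).prod * monomial t α β = monomial t (μ ++ α) β := by
    simp [monomial, mul_assoc]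
  rw [Submodule.mem_comap, LinearMap.mulLeft_apply, heq]
  refine monomial_mem_monomialSpan ⟨fun i hi => ?_, ?_⟩ hβ
  · exact (List.mem_append.1 hi).elim (hμ i) (hα.1 i)
  · simpa using hα.2

end Ring

variable {B : Type*} [CStarAlgebra B] {t : ℕ → B}

theorem IsFamily.star_mul_monomial_mem (ht : IsFamily t) {i n a c b : ℕ} (hi : i ≤ n)
    {α β : List ℕ} (hα : α ∈ words n (Set.Iic a)) (hβ : β ∈ words n (Set.Icc c b)) :
    star (t i) * monomial t α β
      ∈ monomialSpan t (words n (Set.Iic a)) (words n (Set.Icc c (b + 1))) := by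
  have hβk : ∀ k ≤ n, β ++ [k] ∈ words n (Set.Icc c (b + 1)) := by
    grind [mem_words]
  obtain _ | ⟨j, α⟩ := α
  · have heq : star (t i) * monomial t [] β = monomial t [] (β ++ [i]) := by simp [monomial]
    exact heq ▸ monomial_mem_monomialSpan hα (hβk i hi)
  obtain rfl | hij := eq_or_ne i j
  · obtain _ | ⟨k, α⟩ := α
    · have heq : star (t i) * monomial t [i] β
          = ∑ k ∈ Finset.range (i + 1), monomial t [k] (β ++ [k]) := by
        simpa [monomial, mul_assoc, Finset.sum_mul]
          using congrArg (· * star (β.map t).prod) (ht.source_eq i)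
      rw [heq]
      refine sum_mem fun k hk => ?_
      have hk : k ≤ n := (Finset.mem_range_succ_iff.1 hk).trans hi
      exact monomial_mem_monomialSpan (by grind [mem_words]) (hβk k hk)
    · have heq : star (t i) * monomial t (i :: k :: α) β
          = star (t i) * t i * t k * monomial t α β := by
        simp [monomial, mul_assoc]
      rw [heq]
      obtain hk | hk := le_or_gt k i
      · have heq' : t k * monomial t α β = monomial t (k :: α) β := by simp [monomial, mul_assoc]
        rw [ht.source_mul_of_le hk, heq']
        exact monomial_mem_monomialSpan (by grind [mem_words]) (by grind [mem_words])
      · rw [ht.source_mul_of_lt hk, zero_mul]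
        exact zero_mem _
  · have heq : star (t i) * monomial t (j :: α) β = star (t i) * t j * monomial t α β := by
      simp [monomial, mul_assoc]
    rw [heq, ht.orthogonal i j hij, zero_mul]
    exact zero_mem _

theorem IsFamily.star_prod_mul_mem (ht : IsFamily t) {n a c b : ℕ} {ν : List ℕ}
    (hν : ∀ i ∈ ν, i ≤ n) {x : B}
    (hx : x ∈ monomialSpan t (words n (Set.Iic a)) (words n (Set.Icc c b))) :
    star (ν.map t).prod * x
      ∈ monomialSpan t (words n (Set.Iic a)) (words n (Set.Icc c (b + ν.length))) := by
  induction ν generalizing b x with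
  | nil => simpa using hx
  | cons i ν ih =>
    obtain ⟨hi, hν⟩ := List.forall_mem_cons.1 hν
    have hle : monomialSpan t (words n (Set.Iic a)) (words n (Set.Icc c b)) ≤
        (monomialSpan t (words n (Set.Iic a)) (words n (Set.Icc c (b + 1)))).comap
          (LinearMap.mulLeft ℂ (star (t i))) :=
      monomialSpan_le_iff.2 fun α hα β hβ => ht.star_mul_monomial_mem hi hα hβ
    rw [List.map_cons, List.prod_cons, star_mul, mul_assoc, List.length_cons,
      Nat.add_comm ν.length, ← Nat.add_assoc]
    exact ih hν (hle hx)

theorem IsFamily.mul_mem_filtration (ht : IsFamily t) {n d d' : ℕ} {x y : B}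
    (hx : x ∈ filtration t n d) (hy : y ∈ filtration t n d') :
    x * y ∈ filtration t n (d + d') := by
  suffices h : filtration t n d ≤ (filtration t n (d + d')).comap (LinearMap.mulRight ℂ y) from h hx
  refine monomialSpan_le_iff.2 fun μ hμ ν hν => ?_
  rw [Submodule.mem_comap, LinearMap.mulRight_apply, monomial, mul_assoc]
  obtain ⟨hμ, hμ1, hμd⟩ := hμ
  obtain ⟨hν, -, hνd⟩ := hν
  have hy' : y ∈ monomialSpan t (words n (Set.Iic d')) (words n (Set.Icc 1 d')) :=
    monomialSpan_mono (words_mono le_rfl Set.Icc_subset_Iic_self) le_rfl hy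
  refine monomialSpan_mono (words_mono le_rfl ?_) (words_mono le_rfl ?_)
    (prod_mul_mem_monomialSpan hμ (ht.star_prod_mul_mem hν hy'))
  · exact Set.Icc_subset_Icc hμ1 (by omega)
  · exact Set.Icc_subset_Icc_right (by omega)

theorem IsFamily.pow_succ_mem_filtration (ht : IsFamily t) {n d : ℕ} {x : B}
    (hx : x ∈ filtration t n d) (m : ℕ) : x ^ (m + 1) ∈ filtration t n (d * (m + 1)) := by
  induction m with
  | zero => simpa using hx
  | succ m ih =>
    rw [pow_succ, Nat.mul_succ]
    exact ht.mul_mem_filtration ih hx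

theorem IsFamily.gen_mem_filtration (ht : IsFamily t) (i : ℕ) : t i ∈ filtration t i 2 := by
  have heq : t i = ∑ k ∈ Finset.range (i + 1), monomial t [i, k] [k] := by
    simpa [monomial] using ht.monomial_eq_sum [] i []
  rw [heq]
  refine sum_mem fun k hk => ?_
  have hk : k ≤ i := Finset.mem_range_succ_iff.1 hk
  exact monomial_mem_monomialSpan (by simp [mem_words, hk]) (by simp [mem_words, hk])

theorem IsFamily.exists_mem_filtration (ht : IsFamily t) {x : B}
    (hx : x ∈ NonUnitalStarAlgebra.adjoin ℂ (Set.range t)) : ∃ n d, x ∈ filtration t n d := by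
  induction hx using NonUnitalStarAlgebra.adjoin_induction with
  | mem x hx =>
    obtain ⟨i, rfl⟩ := hx
    exact ⟨i, 2, ht.gen_mem_filtration i⟩
  | zero => exact ⟨0, 0, zero_mem _⟩
  | add x y _ _ hx hy =>
    obtain ⟨n, d, hx⟩ := hx
    obtain ⟨n', d', hy⟩ := hy
    exact ⟨max n n', max d d',
      add_mem (filtration_mono (le_max_left _ _) (le_max_left _ _) hx)
        (filtration_mono (le_max_right _ _) (le_max_right _ _) hy)⟩
  | mul x y _ _ hx hy =>
    obtain ⟨n, d, hx⟩ := hx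
    obtain ⟨n', d', hy⟩ := hy
    exact ⟨max n n', d + d',
      ht.mul_mem_filtration (filtration_mono (le_max_left _ _) le_rfl hx)
        (filtration_mono (le_max_right _ _) le_rfl hy)⟩
  | smul c x _ hx =>
    obtain ⟨n, d, hx⟩ := hx
    exact ⟨n, d, Submodule.smul_mem _ _ hx⟩
  | star x _ hx =>
    obtain ⟨n, d, hx⟩ := hx
    exact ⟨n, d, star_mem_monomialSpan hx⟩

theorem IsFamily.monomial_mem_monomialSpan_length_add (ht : IsFamily t) {n b : ℕ} (j : ℕ)
    {μ ν : List ℕ} (h0 : μ ≠ []) (hμ : ∀ i ∈ μ, i ≤ n) (hν : ν ∈ words n (Set.Iic b)) :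
    monomial t μ ν
      ∈ monomialSpan t (words n {μ.length + j}) (words n (Set.Iic (b + j))) := by
  induction j generalizing μ ν b with
  | zero => exact monomial_mem_monomialSpan ⟨hμ, rfl⟩ hν
  | succ j ih =>
    obtain ⟨μ, i, rfl⟩ : ∃ μ' i, μ = μ' ++ [i] :=
      ⟨μ.dropLast, μ.getLast h0, (List.dropLast_append_getLast h0).symm⟩
    rw [ht.monomial_eq_sum]
    refine sum_mem fun k hk => ?_
    have hk : k ≤ n := (Finset.mem_range_succ_iff.1 hk).trans (hμ i (by simp))
    have hνk : ν ++ [k] ∈ words n (Set.Iic (b + 1)) := by grind [mem_words]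
    have hμk : ∀ l ∈ μ ++ [i] ++ [k], l ≤ n := by grind
    have hlen : (μ ++ [i] ++ [k]).length + j = (μ ++ [i]).length + (j + 1) := by
      rw [List.length_append (bs := [k]), List.length_singleton]; omega
    rw [← hlen, show b + (j + 1) = b + 1 + j by omega]
    exact ih (by simp) hμk hνk

theorem IsFamily.filtration_le_monomialSpan (ht : IsFamily t) (n L : ℕ) :
    filtration t n L ≤ monomialSpan t (words n {L}) (words n (Set.Iic (2 * L))) := by
  refine monomialSpan_le_iff.2 fun μ hμ ν hν => ?_
  obtain ⟨hμ, hμ1, hμL⟩ := hμ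
  have h := ht.monomial_mem_monomialSpan_length_add (L - μ.length) (List.length_pos_iff.1 hμ1) hμ
    (words_mono le_rfl Set.Icc_subset_Iic_self hν)
  rw [Nat.add_sub_cancel' hμL] at h
  exact monomialSpan_mono le_rfl (words_mono le_rfl (Set.Iic_subset_Iic.2 (by omega))) h

end MonomialSpan

section DecreasingWords

/-- The weakly decreasing words with letters at most `n` whose length lies in `I`. -/
def decreasingWords (n : ℕ) (I : Set ℕ) : Set (List ℕ) :=
  {μ ∈ words n I | μ.IsChain (· ≥ ·)}

theorem eq_of_isChain_of_count_eq {μ ν : List ℕ} (hμ : μ.IsChain (· ≥ ·))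
    (hν : ν.IsChain (· ≥ ·)) (h : ∀ i, μ.count i = ν.count i) : μ = ν :=
  List.Perm.eq_of_pairwise' hμ.pairwise hν.pairwise (List.perm_iff_count.2 h)

theorem exists_finset_decreasingWords (n : ℕ) {M : ℕ} {I : Set ℕ} (hI : I ⊆ Set.Iic M) :
    ∃ W : Finset (List ℕ), W = decreasingWords n I ∧ W.card ≤ (M + 1) ^ (n + 1) := by
  let counts : List ℕ → Fin (n + 1) → ℕ := fun μ i => μ.count i.1
  let T : Finset (Fin (n + 1) → ℕ) := Fintype.piFinset fun _ => Finset.range (M + 1)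
  have hinj : Set.InjOn counts (decreasingWords n I) := by
    rintro μ ⟨⟨hμn, -⟩, hμ⟩ ν ⟨⟨hνn, -⟩, hν⟩ h
    refine eq_of_isChain_of_count_eq hμ hν fun i => ?_
    obtain hi | hi := lt_or_ge n i
    · rw [List.count_eq_zero.2 fun hm => hi.not_ge (hμn i hm),
        List.count_eq_zero.2 fun hm => hi.not_ge (hνn i hm)]
    · exact congrFun h ⟨i, Nat.lt_succ_of_le hi⟩
  have hmaps : Set.MapsTo counts (decreasingWords n I) T := fun μ hμ =>
    Finset.mem_coe.2 <| Fintype.mem_piFinset.2 fun i => Finset.mem_range_succ_iff.2 <|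
      List.count_le_length.trans (hI hμ.1.2)
  have hfin : (decreasingWords n I).Finite := Set.Finite.of_injOn hmaps hinj T.finite_toSet
  refine ⟨hfin.toFinset, hfin.coe_toFinset, ?_⟩
  calc hfin.toFinset.card ≤ T.card :=
        Finset.card_le_card_of_injOn counts (by simpa using hmaps) (by simpa using hinj)
    _ = (M + 1) ^ (n + 1) := by simp [T]

variable {B : Type*} [CStarAlgebra B] {t : ℕ → B}

theorem IsFamily.monomialSpan_words_le (ht : IsFamily t) (n : ℕ) (I J : Set ℕ) :
    monomialSpan t (words n I) (words n J)
      ≤ monomialSpan t (decreasingWords n I) (decreasingWords n J) := by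
  refine monomialSpan_le_iff.2 fun μ hμ ν hν => ?_
  by_cases h0 : monomial t μ ν = 0
  · exact h0 ▸ zero_mem _
  · obtain ⟨hμ', hν'⟩ := ht.isChain_of_monomial_ne_zero h0
    exact monomial_mem_monomialSpan ⟨hμ, hμ'⟩ ⟨hν, hν'⟩

theorem IsFamily.exists_sum_eq_of_mem_monomialSpan (ht : IsFamily t) {n M : ℕ} {I J : Set ℕ}
    (hI : I ⊆ Set.Iic M) (hJ : J ⊆ Set.Iic M) {x : B}
    (hx : x ∈ monomialSpan t (words n I) (words n J)) :
    ∃ (S : Finset (List ℕ × List ℕ)) (k : List ℕ × List ℕ → ℂ),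
      S = decreasingWords n I ×ˢ decreasingWords n J ∧ S.card ≤ (M + 1) ^ (2 * (n + 1)) ∧
        ∑ p ∈ S, k p • monomial t p.1 p.2 = x := by
  obtain ⟨W, hW, hWcard⟩ := exists_finset_decreasingWords n hI
  obtain ⟨W', hW', hWcard'⟩ := exists_finset_decreasingWords n hJ
  have hS : ((W ×ˢ W' : Finset _) : Set _) = decreasingWords n I ×ˢ decreasingWords n J := by
    rw [Finset.coe_product, hW, hW']
  have hspan := ht.monomialSpan_words_le n I J hx
  rw [monomialSpan, ← Set.image_prod, ← hS] at hspan
  obtain ⟨k, hk⟩ := (Submodule.mem_span_image_finset_iff_exists_fun' ℂ).1 hspan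
  refine ⟨W ×ˢ W', k, hS, ?_, hk⟩
  calc (W ×ˢ W').card = W.card * W'.card := Finset.card_product _ _
    _ ≤ (M + 1) ^ (n + 1) * (M + 1) ^ (n + 1) := Nat.mul_le_mul hWcard hWcard'
    _ = (M + 1) ^ (2 * (n + 1)) := by rw [← pow_add, ← two_mul]

end DecreasingWords

section DropZeros

/-- The word in the letters `1, 2, …` obtained from a word in `0, 1, …` by deleting the zeros. -/
def dropZeros : List ℕ → List ℕ+
  | [] => []
  | 0 :: α => dropZeros α
  | (n + 1) :: α => n.succPNat :: dropZeros α

variable {α β α' β' : List ℕ}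

theorem mem_of_mem_dropZeros {j : ℕ+} (h : j ∈ dropZeros α) : (j : ℕ) ∈ α := by
  induction α with
  | nil => simp [dropZeros] at h
  | cons i α ih =>
    obtain _ | m := i
    · exact List.mem_cons_of_mem _ (ih h)
    · obtain rfl | h := List.mem_cons.1 h
      · simp
      · exact List.mem_cons_of_mem _ (ih h)

theorem isChain_dropZeros (h : α.IsChain (· ≥ ·)) : (dropZeros α).IsChain (· ≥ ·) := by
  rw [List.isChain_iff_pairwise] at h ⊢
  induction h with
  | nil => exact List.Pairwise.nil
  | @cons i α hi _ ih =>
    obtain _ | m := i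
    · exact ih
    · exact List.Pairwise.cons (fun j hj => hi _ (mem_of_mem_dropZeros hj)) ih

theorem dropZeros_eq_nil_of_isChain (h : (0 :: α).IsChain (· ≥ ·)) : dropZeros α = [] := by
  refine List.eq_nil_iff_forall_not_mem.2 fun j hj => ?_
  exact j.pos.not_ge ((List.pairwise_cons.1 h.pairwise).1 _ (mem_of_mem_dropZeros hj))

theorem map_dropZeros_append_replicate (h : α.IsChain (· ≥ ·)) :
    (dropZeros α).map (↑) ++ List.replicate (α.count 0) 0 = α := by
  induction α with
  | nil => rfl
  | cons i α ih =>
    obtain _ | m := i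
    · have ih := ih h.tail
      rw [dropZeros_eq_nil_of_isChain h] at ih
      simpa [dropZeros, dropZeros_eq_nil_of_isChain h, List.replicate_succ] using ih
    · simpa [dropZeros] using ih h.tail

theorem length_dropZeros_add_count (h : α.IsChain (· ≥ ·)) :
    (dropZeros α).length + α.count 0 = α.length := by
  simpa using congrArg List.length (map_dropZeros_append_replicate h)

theorem eq_of_dropZeros_eq_of_count_eq (hα : α.IsChain (· ≥ ·)) (hα' : α'.IsChain (· ≥ ·))
    (h : dropZeros α = dropZeros α') (h0 : α.count 0 = α'.count 0) : α = α' := by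
  rw [← map_dropZeros_append_replicate hα, ← map_dropZeros_append_replicate hα', h, h0]

theorem eq_and_eq_of_dropZeros_eq (hα : α.IsChain (· ≥ ·)) (hβ : β.IsChain (· ≥ ·))
    (hα' : α'.IsChain (· ≥ ·)) (hβ' : β'.IsChain (· ≥ ·)) (hlen : α.length = α'.length)
    (hdα : dropZeros α = dropZeros α') (hdβ : dropZeros β = dropZeros β')
    (h0 : (α.count 0 : ℤ) - β.count 0 = α'.count 0 - β'.count 0) : α = α' ∧ β = β' := by
  have hcount : α.count 0 = α'.count 0 := by
    have h := length_dropZeros_add_count hα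
    have h' := length_dropZeros_add_count hα'
    rw [hdα] at h
    omega
  exact ⟨eq_of_dropZeros_eq_of_count_eq hα hα' hdα hcount,
    eq_of_dropZeros_eq_of_count_eq hβ hβ' hdβ (by omega)⟩

/-- The basis label of the Fock space obtained from a weakly decreasing word in `0, 1, …` by
deleting the zeros. -/
def stripZeros (α : List ℕ) (h : α.IsChain (· ≥ ·)) : Word :=
  ⟨dropZeros α, isChain_dropZeros h⟩

end DropZeros

section MatrixCoefficients

theorem norm_basisVec (w : Word) : ‖basisVec w‖ = 1 := by
  rw [basisVec, lp.norm_single (by norm_num), norm_one]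

theorem inner_basisVec_basisVec (u w : Word) :
    inner ℂ (basisVec u) (basisVec w) = if u = w then (1 : ℂ) else 0 := by
  simp [basisVec, lp.inner_single_left, Pi.single_apply]

theorem vacuumProj_basisVec (w : Word) :
    vacuumProj (basisVec w) = if w.1 = [] then vacuum else 0 := by
  have h : basisVec w ⟨[], List.isChain_nil⟩ = if w.1 = [] then 1 else 0 := by
    simp [basisVec, Pi.single_apply, Subtype.ext_iff, eq_comm]
  rw [vacuumProj_apply, h, ite_smul, one_smul, zero_smul]

theorem creator_basisVec {i : ℕ+} {w : Word} (h : (i :: w.1).IsChain (· ≥ ·)) :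
    creator i (basisVec w) = basisVec ⟨i :: w.1, h⟩ := by
  simp [creator, basisVec, partialOp_single, prepend, h]

theorem star_creator_basisVec_nil (i : ℕ+) (h : [].IsChain (· ≥ ·)) :
    star (creator i) (basisVec ⟨[], h⟩) = 0 := by
  simp [creator, star_partialOp, basisVec, partialOp_single, prepend, PEquiv.symm]

theorem star_creator_basisVec_cons (i j : ℕ+) (l : List ℕ+) (h : (j :: l).IsChain (· ≥ ·)) :
    star (creator i) (basisVec ⟨j :: l, h⟩) = if j = i then basisVec ⟨l, h.tail⟩ else 0 := by
  split_ifs with hj <;>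
    simp [creator, star_partialOp, basisVec, partialOp_single, prepend, PEquiv.symm, hj]

theorem prod_fockFamily_vacuum (z : Circle) {α : List ℕ} (h : α.IsChain (· ≥ ·)) :
    (α.map (fockFamily z)).prod vacuum = (z : ℂ) ^ α.count 0 • basisVec (stripZeros α h) := by
  induction α with
  | nil => simp [stripZeros, dropZeros, vacuum]
  | cons i α ih =>
    rw [List.map_cons, List.prod_cons, mul_apply_eq_comp, ih h.tail, map_smul]
    obtain _ | n := i
    · have hproj : vacuumProj (basisVec (stripZeros α h.tail))
          = basisVec (stripZeros (0 :: α) h) := by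
        have hnil : stripZeros (0 :: α) h = ⟨[], List.isChain_nil⟩ :=
          Subtype.ext (dropZeros_eq_nil_of_isChain (α := α) h)
        exact (vacuumProj_basisVec _).trans
          ((if_pos (dropZeros_eq_nil_of_isChain h)).trans (hnil ▸ rfl))
      rw [List.count_cons_self, pow_succ, mul_smul]
      exact congrArg _ (congrArg ((z : ℂ) • ·) hproj)
    · rw [List.count_cons_of_ne n.succ_ne_zero]
      exact congrArg _ (creator_basisVec (w := stripZeros α h.tail) (isChain_dropZeros h))

theorem star_fockFamily_zero (z : Circle) :
    star (fockFamily z 0) = (z : ℂ)⁻¹ • vacuumProj := by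
  have hproj : star vacuumProj = vacuumProj := isSelfAdjoint_starProjection _
  rw [fockFamily, star_smul, hproj, ← Circle.coe_inv, Circle.coe_inv_eq_conj]
  rfl

theorem star_prod_fockFamily_basisVec (z : Circle) {α : List ℕ} (h : α.IsChain (· ≥ ·)) {w : Word}
    (hw : w.1.length ≤ α.length) :
    star (α.map (fockFamily z)).prod (basisVec w)
      = if w.1 = dropZeros α then ((z : ℂ) ^ α.count 0)⁻¹ • vacuum else 0 := by
  induction α generalizing w with
  | nil =>
    obtain rfl : w = ⟨[], List.isChain_nil⟩ := Subtype.ext (by simpa using hw)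
    simp [dropZeros, vacuum]
  | cons i α ih =>
    rw [List.map_cons, List.prod_cons, star_mul, mul_apply_eq_comp]
    obtain _ | n := i
    · have hnil := dropZeros_eq_nil_of_isChain h
      have hvac : star (α.map (fockFamily z)).prod vacuum = ((z : ℂ) ^ α.count 0)⁻¹ • vacuum := by
        rw [vacuum, ih h.tail (Nat.zero_le _), if_pos hnil.symm, vacuum]
      rw [star_fockFamily_zero, smul_apply, vacuumProj_basisVec, map_smul, dropZeros, hnil]
      split_ifs
      · rw [hvac, smul_smul, List.count_cons_self, pow_succ', mul_inv]
      · rw [map_zero, smul_zero]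
    · change star (α.map (fockFamily z)).prod (star (creator n.succPNat) (basisVec w)) = _
      rw [List.count_cons_of_ne n.succ_ne_zero, dropZeros]
      obtain ⟨_ | ⟨j, l⟩, hl⟩ := w
      · rw [star_creator_basisVec_nil, map_zero, if_neg (List.cons_ne_nil _ _).symm]
      · rw [star_creator_basisVec_cons]
        simp only [List.cons.injEq, ite_and]
        split_ifs with hj hl'
        · rw [ih h.tail (Nat.le_of_succ_le_succ hw), if_pos hl']
        · rw [ih h.tail (Nat.le_of_succ_le_succ hw), if_neg hl']
        · exact map_zero _

theorem inner_monomial_fockFamily (z : Circle) {α β : List ℕ} (hα : α.IsChain (· ≥ ·))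
    (hβ : β.IsChain (· ≥ ·)) {u : Word} (hu : u.1.length ≤ α.length) (w : Word) :
    inner ℂ (basisVec u) (monomial (fockFamily z) α β (basisVec w))
      = if u.1 = dropZeros α ∧ w.1 = dropZeros β then
          (z : ℂ) ^ ((α.count 0 : ℤ) - β.count 0) else 0 := by
  have hconj : starRingEnd ℂ (z : ℂ) = (z : ℂ)⁻¹ := by
    rw [← Circle.coe_inv_eq_conj, Circle.coe_inv]
  have hvac : inner ℂ vacuum (star (β.map (fockFamily z)).prod (basisVec w))
      = if w.1 = dropZeros β then ((z : ℂ) ^ β.count 0)⁻¹ else 0 := by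
    rw [ContinuousLinearMap.star_eq_adjoint, ContinuousLinearMap.adjoint_inner_right,
      prod_fockFamily_vacuum z hβ, inner_smul_left, inner_basisVec_basisVec, mul_ite, mul_one,
      mul_zero, map_pow, hconj, inv_pow]
    exact if_congr (Subtype.ext_iff.trans eq_comm) rfl rfl
  rw [monomial, mul_apply_eq_comp, ← ContinuousLinearMap.adjoint_inner_left,
    ← ContinuousLinearMap.star_eq_adjoint, star_prod_fockFamily_basisVec z hα hu, ite_and]
  split_ifs with hu' hw'
  · rw [inner_smul_left, hvac, if_pos hw', map_inv₀, map_pow, hconj, inv_pow, inv_inv,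
      zpow_sub₀ (Circle.coe_ne_zero z), zpow_natCast, zpow_natCast, div_eq_mul_inv]
  · rw [inner_smul_left, hvac, if_neg hw', mul_zero]
  · rw [inner_zero_left]

end MatrixCoefficients

section Fourier

theorem norm_fourierCoeff_le {T : ℝ} [Fact (0 < T)] {E : Type*} [NormedAddCommGroup E]
    [NormedSpace ℂ E] {f : AddCircle T → E} {C : ℝ} (hf : ∀ x, ‖f x‖ ≤ C) (m : ℤ) :
    ‖fourierCoeff f m‖ ≤ C := by
  have hbound : ∀ x, ‖fourier (-m) x • f x‖ ≤ C := fun x => by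
    rw [norm_smul, fourier_apply, Circle.norm_coe, one_mul]
    exact hf x
  simpa [fourierCoeff] using
    MeasureTheory.norm_integral_le_of_norm_le_const (μ := AddCircle.haarAddCircle)
      (Filter.Eventually.of_forall hbound)

theorem norm_sum_filter_le_of_circle {ι : Type*} (S : Finset ι) (k : ι → ℂ) (n : ι → ℤ) {C : ℝ}
    (hC : ∀ z : Circle, ‖∑ i ∈ S, k i * (z : ℂ) ^ n i‖ ≤ C) (m : ℤ) :
    ‖∑ i ∈ S with n i = m, k i‖ ≤ C := by
  let f : UnitAddCircle → ℂ := ∑ i ∈ S, k i • ⇑(fourier (n i) : C(UnitAddCircle, ℂ))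
  have hf : ∀ x, f x = ∑ i ∈ S, k i * (AddCircle.toCircle x : ℂ) ^ n i := fun x => by
    simp [f, fourier_apply, AddCircle.toCircle_zsmul]
  have hcoeff : fourierCoeff f m = ∑ i ∈ S with n i = m, k i := by
    have hint : ∀ i ∈ S, MeasureTheory.Integrable
        (k i • ⇑(fourier (n i) : C(UnitAddCircle, ℂ))) AddCircle.haarAddCircle := fun i _ =>
      ((fourier (n i)).continuous.const_smul (k i)).integrable_of_hasCompactSupport
        (HasCompactSupport.of_compactSpace _)
    rw [fourierCoeff.sum S _ hint, Finset.sum_apply, Finset.sum_filter]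
    refine Finset.sum_congr rfl fun i _ => ?_
    rw [fourierCoeff.const_smul, fourierCoeff_fourier, Pi.single_apply, smul_ite, smul_zero,
      smul_eq_mul, mul_one]
    exact if_congr eq_comm rfl rfl
  rw [← hcoeff]
  exact norm_fourierCoeff_le (fun x => (hf x).symm ▸ hC _) m

end Fourier

section CoefficientBound

theorem norm_coeff_le_of_norm_sum_monomial_fockFamily_le {S : Finset (List ℕ × List ℕ)} {L : ℕ}
    (hS : ∀ p ∈ S, p.1.length = L ∧ p.1.IsChain (· ≥ ·) ∧ p.2.IsChain (· ≥ ·))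
    (k : List ℕ × List ℕ → ℂ) {C : ℝ}
    (hC : ∀ z, ‖∑ p ∈ S, k p • monomial (fockFamily z) p.1 p.2‖ ≤ C) {p : List ℕ × List ℕ}
    (hp : p ∈ S) : ‖k p‖ ≤ C := by
  obtain ⟨hpL, hα, hβ⟩ := hS p hp
  let S' := S.filter fun q => dropZeros p.1 = dropZeros q.1 ∧ dropZeros p.2 = dropZeros q.2
  let zeros : List ℕ × List ℕ → ℤ := fun q => (q.1.count 0 : ℤ) - q.2.count 0
  have hsingle : {q ∈ S' | zeros q = zeros p} = {p} := by
    refine Finset.eq_singleton_iff_unique_mem.2 ⟨by simp [S', hp], fun q hq => ?_⟩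
    obtain ⟨hq, hzeros⟩ := Finset.mem_filter.1 hq
    obtain ⟨hq, h1, h2⟩ := Finset.mem_filter.1 hq
    obtain ⟨hqL, hα', hβ'⟩ := hS q hq
    exact Prod.ext_iff.2 <|
      eq_and_eq_of_dropZeros_eq hα' hβ' hα hβ (hqL.trans hpL.symm) h1.symm h2.symm hzeros
  suffices h : ∀ z : Circle, ‖∑ q ∈ S', k q * (z : ℂ) ^ zeros q‖ ≤ C by
    simpa [hsingle] using norm_sum_filter_le_of_circle S' k zeros h (zeros p)
  intro z
  let u := stripZeros p.1 hα
  let w := stripZeros p.2 hβ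
  have hcoeff : ∑ q ∈ S', k q * (z : ℂ) ^ zeros q
      = inner ℂ (basisVec u) ((∑ q ∈ S, k q • monomial (fockFamily z) q.1 q.2) (basisVec w)) := by
    rw [sum_apply, inner_sum, Finset.sum_filter]
    refine Finset.sum_congr rfl fun q hq => ?_
    obtain ⟨hqL, hα', hβ'⟩ := hS q hq
    have hu : u.1.length ≤ q.1.length := by
      have := length_dropZeros_add_count hα
      exact hqL ▸ hpL ▸ Nat.le.intro this
    rw [smul_apply, inner_smul_right, inner_monomial_fockFamily z hα' hβ' hu, mul_ite, mul_zero]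
    rfl
  calc ‖∑ q ∈ S', k q * (z : ℂ) ^ zeros q‖
      ≤ ‖basisVec u‖ * ‖(∑ q ∈ S, k q • monomial (fockFamily z) q.1 q.2) (basisVec w)‖ :=
        hcoeff ▸ norm_inner_le_norm _ _
    _ ≤ ‖∑ q ∈ S, k q • monomial (fockFamily z) q.1 q.2‖ := by
        simpa [norm_basisVec] using
          (∑ q ∈ S, k q • monomial (fockFamily z) q.1 q.2).le_opNorm (basisVec w)
    _ ≤ C := hC z

end CoefficientBound

section Estimate

theorem le_of_frequently_pow_le {x y K : ℝ} (hy : 0 ≤ y) (r : ℕ)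
    (h : ∃ᶠ m : ℕ in Filter.atTop, x ^ m ≤ K * m ^ r * y ^ m) : x ≤ y := by
  by_contra! hxy
  have hx : 0 < x := hy.trans_lt hxy
  have hlim := (tendsto_pow_const_mul_const_pow_of_lt_one r (div_nonneg hy hx.le)
    ((div_lt_one hx).2 hxy)).const_mul K
  rw [mul_zero] at hlim
  obtain ⟨m, hm, hm'⟩ := (h.and_eventually (hlim.eventually_lt_const one_pos)).exists
  rw [← mul_assoc, div_pow, ← mul_div_assoc, div_lt_one (pow_pos hx m)] at hm'
  exact hm.not_gt hm'

variable {B : Type*} [CStarAlgebra B] {t : ℕ → B}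

theorem IsFamily.norm_le_of_mem_filtration (ht : IsFamily t)
    (φ : Circle → B →⋆ₐ[ℂ] (Fock →L[ℂ] Fock)) (hφ : ∀ z i, φ z (t i) = fockFamily z i)
    {n L : ℕ} {x : B} (hx : x ∈ filtration t n L) {C : ℝ} (hC : ∀ z, ‖φ z x‖ ≤ C) :
    ‖x‖ ≤ (2 * L + 1) ^ (2 * (n + 1)) * C := by
  have hL : ({L} : Set ℕ) ⊆ Set.Iic (2 * L) := by simp [two_mul]
  obtain ⟨S, k, hS, hcard, rfl⟩ :=
    ht.exists_sum_eq_of_mem_monomialSpan hL le_rfl (ht.filtration_le_monomialSpan n L hx)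
  have hC0 : 0 ≤ C := (norm_nonneg _).trans (hC 1)
  have hwords : ∀ p ∈ S, p.1.length = L ∧ p.1.IsChain (· ≥ ·) ∧ p.2.IsChain (· ≥ ·) := by
    intro p hp
    obtain ⟨hp1, hp2⟩ := Set.mem_prod.1 (hS ▸ Finset.mem_coe.2 hp)
    exact ⟨hp1.1.2, hp1.2, hp2.2⟩
  have hsum : ∀ z, φ z (∑ p ∈ S, k p • monomial t p.1 p.2)
      = ∑ p ∈ S, k p • monomial (fockFamily z) p.1 p.2 := fun z => by
    simp only [map_sum, map_smul, map_monomial, hφ]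
  have hk : ∀ p ∈ S, ‖k p • monomial t p.1 p.2‖ ≤ C := fun p hp => by
    have hkp : ‖k p‖ ≤ C :=
      norm_coeff_le_of_norm_sum_monomial_fockFamily_le hwords k (fun z => hsum z ▸ hC z) hp
    rw [norm_smul]
    exact (mul_le_of_le_one_right (norm_nonneg _) (norm_monomial_le_one ht.norm_le_one _ _)).trans
      hkp
  calc ‖∑ p ∈ S, k p • monomial t p.1 p.2‖
      ≤ S.card * C := (norm_sum_le_of_le S hk).trans_eq (by rw [Finset.sum_const, nsmul_eq_mul])
    _ ≤ (2 * L + 1) ^ (2 * (n + 1)) * C :=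
        mul_le_mul_of_nonneg_right (by exact_mod_cast hcard) hC0

theorem IsFamily.norm_pow_le_of_mem_filtration (ht : IsFamily t)
    (φ : Circle → B →⋆ₐ[ℂ] (Fock →L[ℂ] Fock)) (hφ : ∀ z i, φ z (t i) = fockFamily z i)
    {n d : ℕ} {x : B} (hx : x ∈ filtration t n d) {C : ℝ} (hC : ∀ z, ‖φ z x‖ ≤ C) {m : ℕ}
    (hm : 0 < m) :
    ‖x ^ m‖ ≤ (2 * d + 1) ^ (2 * (n + 1)) * m ^ (2 * (n + 1)) * C ^ m := by
  have hC0 : 0 ≤ C := (norm_nonneg _).trans (hC 1)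
  have hpow : x ^ m ∈ filtration t n (d * m) := by
    obtain ⟨m, rfl⟩ := Nat.exists_eq_add_one.2 hm
    exact ht.pow_succ_mem_filtration hx m
  have hbound : ∀ z, ‖φ z (x ^ m)‖ ≤ C ^ m := fun z => by
    rw [map_pow]
    exact (norm_pow_le' _ hm).trans (pow_le_pow_left₀ (norm_nonneg _) (hC z) m)
  refine (ht.norm_le_of_mem_filtration φ hφ hpow hbound).trans ?_
  rw [← mul_pow]
  have hm1 : (1 : ℝ) ≤ m := by exact_mod_cast hm
  gcongr
  push_cast
  linarith

theorem IsFamily.norm_le_of_isSelfAdjoint (ht : IsFamily t)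
    (φ : Circle → B →⋆ₐ[ℂ] (Fock →L[ℂ] Fock)) (hφ : ∀ z i, φ z (t i) = fockFamily z i) {x : B}
    (hsa : IsSelfAdjoint x) (hx : x ∈ NonUnitalStarAlgebra.adjoin ℂ (Set.range t)) {C : ℝ}
    (hC : ∀ z, ‖φ z x‖ ≤ C) : ‖x‖ ≤ C := by
  obtain ⟨n, d, hx⟩ := ht.exists_mem_filtration hx
  have hpow : ∀ k : ℕ, ‖x‖ ^ 2 ^ k
      ≤ (2 * d + 1) ^ (2 * (n + 1)) * (2 ^ k : ℕ) ^ (2 * (n + 1)) * C ^ 2 ^ k := fun k => by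
    rw [← hsa.norm_pow_two_pow]
    exact ht.norm_pow_le_of_mem_filtration φ hφ hx hC (by positivity)
  exact le_of_frequently_pow_le ((norm_nonneg _).trans (hC 1)) _ <|
    (tendsto_pow_atTop_atTop_of_one_lt one_lt_two).frequently (Filter.Frequently.of_forall hpow)

theorem IsFamily.norm_le_of_forall_norm_le (ht : IsFamily t)
    (φ : Circle → B →⋆ₐ[ℂ] (Fock →L[ℂ] Fock)) (hφ : ∀ z i, φ z (t i) = fockFamily z i) {x : B}
    (hx : x ∈ NonUnitalStarAlgebra.adjoin ℂ (Set.range t)) {C : ℝ} (hC : ∀ z, ‖φ z x‖ ≤ C) :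
    ‖x‖ ≤ C := by
  have hC0 : 0 ≤ C := (norm_nonneg _).trans (hC 1)
  have hstar : ∀ z, ‖φ z (star x * x)‖ ≤ C ^ 2 := fun z => by
    rw [map_mul, map_star, sq]
    exact (norm_mul_le _ _).trans
      (mul_le_mul ((norm_star _).trans_le (hC z)) (hC z) (norm_nonneg _) hC0)
  have hsq : ‖x‖ ^ 2 ≤ C ^ 2 := by
    rw [sq, ← CStarRing.norm_star_mul_self]
    exact ht.norm_le_of_isSelfAdjoint φ hφ (IsSelfAdjoint.star_mul_self x)
      (mul_mem (star_mem hx) hx) hstar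
  exact le_of_sq_le_sq hsq hC0

end Estimate

section Faithful

open UniversalAlgebra

theorem norm_le_of_mem_adjoin_gen {x : UniversalAlgebra}
    (hx : x ∈ NonUnitalStarAlgebra.adjoin ℂ (Set.range gen)) {C : ℝ}
    (hC : ∀ z, ‖fockRep z x‖ ≤ C) : ‖x‖ ≤ C := by
  let ι : UniversalAlgebra →⋆ₙₐ[ℂ] Unitization ℂ UniversalAlgebra :=
    Unitization.inrNonUnitalStarAlgHom ℂ UniversalAlgebra
  have hlift : ∀ z y, Unitization.starLift (fockRep z) (ι y) = fockRep z y := fun z y =>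
    DFunLike.congr_fun (Unitization.starLift.symm_apply_apply (fockRep z)) y
  have hmem : ι x ∈ NonUnitalStarAlgebra.adjoin ℂ (Set.range fun i => ι (gen i)) := by
    have hrange : (Set.range fun i => ι (gen i)) = ι '' Set.range gen := Set.range_comp ι gen
    rw [hrange, ← NonUnitalStarAlgHom.map_adjoin]
    exact ⟨x, hx, rfl⟩
  have hnorm : ‖ι x‖ = ‖x‖ := Unitization.norm_inr x
  rw [← hnorm]
  exact (isFamily_gen.map ι).norm_le_of_forall_norm_le (fun z => Unitization.starLift (fockRep z))
    (fun z i => hlift z (gen i)) hmem fun z => (hlift z x).symm ▸ hC z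

theorem dense_adjoin_gen :
    Dense (NonUnitalStarAlgebra.adjoin ℂ (Set.range gen) : Set UniversalAlgebra) := by
  have hrange : (Set.range ambientGen : Set Ambient)
      = NonUnitalStarSubalgebraClass.subtype universalSubalgebra '' Set.range gen := by
    rw [← Set.range_comp]; rfl
  have himage : (NonUnitalStarAlgebra.adjoin ℂ (Set.range ambientGen) : Set Ambient)
      = (↑) '' (NonUnitalStarAlgebra.adjoin ℂ (Set.range gen) : Set UniversalAlgebra) := by
    rw [hrange, ← NonUnitalStarAlgHom.map_adjoin]; rfl
  exact Subtype.dense_iff.2 (himage ▸ le_rfl)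

theorem norm_apply_le_norm_directSumRep {ι : Type*} {H : ι → Type*}
    [∀ i, NormedAddCommGroup (H i)] [∀ i, InnerProductSpace ℂ (H i)] [∀ i, CompleteSpace (H i)]
    {A : Type*} [NonUnitalCStarAlgebra A] (π : ∀ i, A →⋆ₙₐ[ℂ] (H i →L[ℂ] H i)) (i : ι) (a : A) :
    ‖π i a‖ ≤ ‖directSumRep π a‖ := by
  classical
  refine ContinuousLinearMap.opNorm_le_bound _ (norm_nonneg _) fun v => ?_
  calc ‖π i a v‖ = ‖directSumRep π a (lp.single 2 i v) i‖ := by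
        rw [directSumRep_apply, lp.single_apply_self]
    _ ≤ ‖directSumRep π a (lp.single 2 i v)‖ := lp.norm_apply_le_norm two_ne_zero _ i
    _ ≤ ‖directSumRep π a‖ * ‖v‖ := by
        simpa only [lp.norm_single two_pos] using
          (directSumRep π a).le_opNorm (lp.single 2 i v)

open scoped CStarAlgebra in
theorem norm_le_norm_directSumRep_fockRep (x : UniversalAlgebra) :
    ‖x‖ ≤ ‖directSumRep fockRep x‖ := by
  induction x using dense_adjoin_gen.induction with
  | mem x hx => exact norm_le_of_mem_adjoin_gen hx fun z => norm_apply_le_norm_directSumRep _ z x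
  | isClosed => exact isClosed_le continuous_norm (map_continuous (directSumRep fockRep)).norm

end Faithful

end WeaklyMonotone

theorem mainTheorem7 :
    Function.Injective
      (WeaklyMonotone.directSumRep fun z : Circle => WeaklyMonotone.fockRep z) := by
  refine (AddMonoidHomClass.antilipschitz_of_bound (K := 1) _ fun x => ?_).injective
  rw [NNReal.coe_one, one_mul]
  exact WeaklyMonotone.norm_le_norm_directSumRep_fockRep x
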